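/- \textbf{Theorem (Ky Fan multiplicative inequality).} Let $A$ be a (complex, not necessarily unital) C$^*$-algebra. Let $P(A)$ be the set of projections of $A$ and $P_\infty(A)=\bigcup_{n\ge 1}P(M_n(A))$. For $p\in P_\infty(A)$ let $[p]_0\in K_0(A)$ denote its class, let $K_0(A)^+=\{[p]_0 : p\in P_\infty(A)\}$ be the positive cone of $K_0(A)$, and write $x\le y$ in $K_0(A)$ if $y-x\in K_0(A)^+$. Let $D_0(A)=\{[p]_0 : p\in P(A)\}$ be the dimension range of $A$. For $a\in A$ and $g\in K_0(A)^+$ put \[ s_g(a)=\inf\{\|a-ap\| : p\in P(A),\ [p]_0\le g\}. \] Assume that (i) $A$ has cancellation: for all $p,q\in P_\infty(A)$, $[p]_0=[q]_0$ if and only if $p$ and $q$ are Murray--von Neumann equivalent (that is, $p=v^*v$ and $q=vv^*$ for some rectangular matrix $v$ over $A$); (ii) $A$ has real rank zero: the invertible self-adjoint elements of the unitization of $A$ are dense in the set of its self-adjoint elements; (iii) $K_0(A)^+=D_0(A)$. Then \[ s_{g+h}(ab)\le s_g(a)\,s_h(b)\qquad\text{for all } a,b\in A \text{ and all } g,h\in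 K_0(A)^+. \] -/

import Mathlib

open scoped Matrix

universe u

noncomputable section

namespace CStarK

/-! ### Projections in matrix algebras and Murray--von Neumann equivalence -/

/-- Murray--von Neumann equivalence of square matrices of possibly different sizes:
`p = v* v` and `q = v v*` for a rectangular matrix `v` with entries in `B`. -/
def MvN {B : Type u} [NonUnitalRing B] [StarRing B] {m n : Type*} [Fintype m] [Fintype n]
    (p : Matrix m m B) (q : Matrix n n B) : Prop :=
  ∃ v : Matrix n m B, vᴴ * v = p ∧ v * vᴴ = q

/-- `P_∞(B)`: the projections in the matrix algebras `M_n(B)`, together with their size.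
The size `n = 0` is allowed; its only element is equivalent to the zero projection of `B`. -/
structure MatProj (B : Type u) [NonUnitalRing B] [StarRing B] : Type u where
  size : ℕ
  mat : Matrix (Fin size) (Fin size) B
  isProj : IsStarProjection mat

section Ring

variable {B : Type u} [NonUnitalRing B] [StarRing B]

theorem MvN.of_submatrix {m n : Type*} [Fintype m] [Fintype n] {q : Matrix n n B}
    (hq : IsStarProjection q) (e : m ≃ n) : MvN (q.submatrix e e) q := by
  have h1 : q * q = q := hq.isIdempotentElem
  have h2 : qᴴ = q := hq.isSelfAdjoint
  refine ⟨q.submatrix id e, ?_, ?_⟩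
  · rw [Matrix.conjTranspose_submatrix, h2]
    conv_rhs => rw [← h1]
    exact Matrix.submatrix_mul_equiv q q e (Equiv.refl n) e
  · rw [Matrix.conjTranspose_submatrix, h2]
    conv_rhs => rw [← h1]
    exact Matrix.submatrix_mul_equiv q q id e id

theorem MvN.symm {m n : Type*} [Fintype m] [Fintype n] {p : Matrix m m B} {q : Matrix n n B}
    (h : MvN p q) : MvN q p := by
  obtain ⟨v, h1, h2⟩ := h
  exact ⟨vᴴ, by rwa [Matrix.conjTranspose_conjTranspose],
    by rwa [Matrix.conjTranspose_conjTranspose]⟩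

theorem MvN.trans {l m n : Type*} [Fintype l] [Fintype m] [Fintype n] {p : Matrix l l B}
    {q : Matrix m m B} {r : Matrix n n B} (hp : IsStarProjection p) (hr : IsStarProjection r)
    (h : MvN p q) (h' : MvN q r) : MvN p r := by
  obtain ⟨v, rfl, h2⟩ := h
  obtain ⟨w, h3, rfl⟩ := h'
  have hp' : vᴴ * v * (vᴴ * v) = vᴴ * v := hp.isIdempotentElem
  have hr' : w * wᴴ * (w * wᴴ) = w * wᴴ := hr.isIdempotentElem
  refine ⟨w * v, ?_, ?_⟩
  · calc (w * v)ᴴ * (w * v) = vᴴ * (wᴴ * w) * v := by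
          simp only [Matrix.conjTranspose_mul, Matrix.mul_assoc]
      _ = vᴴ * v * (vᴴ * v) := by rw [h3, ← h2]; simp only [Matrix.mul_assoc]
      _ = vᴴ * v := hp'
  · calc (w * v) * (w * v)ᴴ = w * (v * vᴴ) * wᴴ := by
          simp only [Matrix.conjTranspose_mul, Matrix.mul_assoc]
      _ = w * wᴴ * (w * wᴴ) := by rw [h2, ← h3]; simp only [Matrix.mul_assoc]
      _ = w * wᴴ := hr'

/-- The block diagonal sum of projections is a projection. -/
theorem isStarProjection_fromBlocks {m n : Type*} [Fintype m] [Fintype n] {p : Matrix m m B}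
    {q : Matrix n n B} (hp : IsStarProjection p) (hq : IsStarProjection q) :
    IsStarProjection (Matrix.fromBlocks p 0 0 q) := by
  have h1 : p * p = p := hp.isIdempotentElem
  have h2 : pᴴ = p := hp.isSelfAdjoint
  have h3 : q * q = q := hq.isIdempotentElem
  have h4 : qᴴ = q := hq.isSelfAdjoint
  refine ⟨?_, ?_⟩
  · change _ * _ = _
    simp [Matrix.fromBlocks_multiply, h1, h3]
  · change Matrix.conjTranspose _ = _
    simp [Matrix.fromBlocks_conjTranspose, h2, h4]

theorem isStarProjection_submatrix {m n : Type*} [Fintype m] [Fintype n] {q : Matrix n n B}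
    (hq : IsStarProjection q) (e : m ≃ n) : IsStarProjection (q.submatrix e e) := by
  have h1 : q * q = q := hq.isIdempotentElem
  have h2 : qᴴ = q := hq.isSelfAdjoint
  refine ⟨?_, ?_⟩
  · change _ * _ = _
    rw [Matrix.submatrix_mul_equiv, h1]
  · change Matrix.conjTranspose _ = _
    rw [Matrix.conjTranspose_submatrix, h2]

theorem MvN.fromBlocks {m n m' n' : Type*} [Fintype m] [Fintype n] [Fintype m'] [Fintype n']
    {p : Matrix m m B} {q : Matrix n n B} {p' : Matrix m' m' B} {q' : Matrix n' n' B}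
    (h : MvN p p') (h' : MvN q q') :
    MvN (Matrix.fromBlocks p 0 0 q) (Matrix.fromBlocks p' 0 0 q') := by
  obtain ⟨v, rfl, rfl⟩ := h
  obtain ⟨w, rfl, rfl⟩ := h'
  refine ⟨Matrix.fromBlocks v 0 0 w, ?_, ?_⟩ <;>
    simp [Matrix.fromBlocks_multiply, Matrix.fromBlocks_conjTranspose]

/-- The direct sum `p ⊕ q = diag(p, q)` in `M_{m+n}(B)`. -/
def MatProj.sum (p q : MatProj B) : MatProj B where
  size := p.size + q.size
  mat := (Matrix.fromBlocks p.mat 0 0 q.mat).submatrix finSumFinEquiv.symm finSumFinEquiv.symm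
  isProj := isStarProjection_submatrix (isStarProjection_fromBlocks p.isProj q.isProj) _

/-- The empty (`0 × 0`) projection. -/
def MatProj.empty : MatProj B where
  size := 0
  mat := 0
  isProj := IsStarProjection.zero _

/-- A projection of `B`, viewed as a `1 × 1` matrix. -/
def MatProj.single (p : B) (hp : IsStarProjection p) : MatProj B where
  size := 1
  mat := Matrix.of fun _ _ => p
  isProj := by
    have h1 : p * p = p := hp.isIdempotentElem
    have h2 : star p = p := hp.isSelfAdjoint
    refine ⟨?_, ?_⟩
    · change _ * _ = _
      ext i j
      rw [Matrix.mul_apply]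
      simp [h1]
    · change Matrix.conjTranspose _ = _
      ext i j
      rw [Matrix.conjTranspose_apply]
      simp [h2]

theorem MatProj.mvn_sum (p q : MatProj B) :
    MvN (p.sum q).mat (Matrix.fromBlocks p.mat 0 0 q.mat) :=
  MvN.of_submatrix (isStarProjection_fromBlocks p.isProj q.isProj) _

variable (B) in
/-- Murray--von Neumann equivalence on `P_∞(B)`. -/
instance matProjSetoid : Setoid (MatProj B) where
  r p q := MvN p.mat q.mat
  iseqv :=
    { refl := fun p => by simpa using MvN.of_submatrix p.isProj (Equiv.refl _)
      symm := MvN.symm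
      trans := fun {p _ r} h h' => MvN.trans p.isProj r.isProj h h' }

variable (B) in
/-- The semigroup of Murray--von Neumann equivalence classes of projections in `P_∞(B)`. -/
def V : Type u := Quotient (matProjSetoid B)

/-- The Murray--von Neumann class of a projection in `P_∞(B)`. -/
def V.mk (p : MatProj B) : V B := Quotient.mk _ p

theorem V.mk_eq_mk {p q : MatProj B} : V.mk p = V.mk q ↔ MvN p.mat q.mat := Quotient.eq

theorem MatProj.sum_congr {p q p' q' : MatProj B} (h : MvN p.mat p'.mat) (h' : MvN q.mat q'.mat) :
    MvN (p.sum q).mat (p'.sum q').mat := by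
  have a := p.mvn_sum q
  have b := (p'.mvn_sum q').symm
  have hb := isStarProjection_fromBlocks p'.isProj q'.isProj
  exact ((a.trans (p.sum q).isProj hb (h.fromBlocks h'))).trans (p.sum q).isProj
    (p'.sum q').isProj b

instance : Add (V B) :=
  ⟨Quotient.map₂ MatProj.sum fun _ _ h _ _ h' => MatProj.sum_congr h h'⟩

instance : Zero (V B) := ⟨V.mk MatProj.empty⟩

theorem V.mk_sum (p q : MatProj B) : V.mk (p.sum q) = V.mk p + V.mk q := rfl

theorem V.zero_def : (0 : V B) = V.mk MatProj.empty := rfl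

theorem V.add_comm' (x y : V B) : x + y = y + x := by
  induction x using Quotient.inductionOn with | _ p
  induction y using Quotient.inductionOn with | _ q
  refine V.mk_eq_mk.2 ?_
  refine (p.mvn_sum q).trans (p.sum q).isProj (q.sum p).isProj (MvN.trans
    (isStarProjection_fromBlocks p.isProj q.isProj) (q.sum p).isProj ?_ (q.mvn_sum p).symm)
  have h := MvN.of_submatrix (isStarProjection_fromBlocks q.isProj p.isProj) (Equiv.sumComm _ _)
  rwa [Equiv.sumComm_apply, Matrix.fromBlocks_submatrix_sum_swap_sum_swap] at h

theorem V.zero_add' (x : V B) : 0 + x = x := by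
  induction x using Quotient.inductionOn with | _ p
  refine V.mk_eq_mk.2 ?_
  refine ((MatProj.empty (B := B)).mvn_sum p).trans (MatProj.sum _ p).isProj p.isProj ?_
  have h := (MvN.of_submatrix (isStarProjection_fromBlocks (MatProj.empty (B := B)).isProj p.isProj)
    (Equiv.emptySum (Fin 0) (Fin p.size)).symm).symm
  exact h

theorem V.add_assoc' (x y z : V B) : x + y + z = x + (y + z) := by
  induction x using Quotient.inductionOn with | _ p
  induction y using Quotient.inductionOn with | _ q
  induction z using Quotient.inductionOn with | _ r
  refine V.mk_eq_mk.2 ?_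
  have hpq := isStarProjection_fromBlocks p.isProj q.isProj
  have hqr := isStarProjection_fromBlocks q.isProj r.isProj
  have hl := isStarProjection_fromBlocks hpq r.isProj
  have hr := isStarProjection_fromBlocks p.isProj hqr
  have refl' : ∀ s : MatProj B, MvN s.mat s.mat := fun s => Setoid.refl s
  have a : MvN ((p.sum q).sum r).mat _ :=
    ((p.sum q).mvn_sum r).trans ((p.sum q).sum r).isProj hl ((p.mvn_sum q).fromBlocks (refl' r))
  have b : MvN (p.sum (q.sum r)).mat _ :=
    (p.mvn_sum (q.sum r)).trans (p.sum (q.sum r)).isProj hr ((refl' p).fromBlocks (q.mvn_sum r))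
  refine a.trans ((p.sum q).sum r).isProj (p.sum (q.sum r)).isProj (MvN.trans hl
    (p.sum (q.sum r)).isProj ?_ b.symm)
  have h := MvN.of_submatrix hr (Equiv.sumAssoc _ _ _)
  convert h using 1
  ext i j
  rcases i with (i | i) | i <;> rcases j with (j | j) | j <;> rfl

instance : AddCommMonoid (V B) where
  add_assoc := V.add_assoc'
  zero_add := V.zero_add'
  add_zero x := by rw [V.add_comm', V.zero_add']
  add_comm := V.add_comm'
  nsmul := nsmulRec

end Ring

/-! ### Functoriality -/

section Functoriality

variable {B C : Type*} [NonUnitalRing B] [StarRing B] [Module ℂ B]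
  [NonUnitalRing C] [StarRing C] [Module ℂ C]

theorem map_mul_map (φ : B →⋆ₙₐ[ℂ] C) {l m n : Type*} [Fintype m] (x : Matrix l m B)
    (y : Matrix m n B) : (x * y).map φ = x.map φ * y.map φ := by
  ext i j
  simp [Matrix.mul_apply, map_sum]

theorem map_conjTranspose_map (φ : B →⋆ₙₐ[ℂ] C) {m n : Type*} (x : Matrix m n B) :
    xᴴ.map φ = (x.map φ)ᴴ := by
  ext i j
  simp [Matrix.conjTranspose_apply, map_star]

/-- Entrywise application of a `*`-homomorphism to a projection in `P_∞(B)`. -/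
def MatProj.map (φ : B →⋆ₙₐ[ℂ] C) (p : MatProj B) : MatProj C where
  size := p.size
  mat := p.mat.map φ
  isProj := by
    have h1 : p.mat * p.mat = p.mat := p.isProj.isIdempotentElem
    have h2 : p.matᴴ = p.mat := p.isProj.isSelfAdjoint
    refine ⟨?_, ?_⟩
    · change _ * _ = _
      rw [← map_mul_map, h1]
    · change Matrix.conjTranspose _ = _
      rw [← map_conjTranspose_map, h2]

theorem MvN.map (φ : B →⋆ₙₐ[ℂ] C) {m n : Type*} [Fintype m] [Fintype n] {p : Matrix m m B}
    {q : Matrix n n B} (h : MvN p q) : MvN (p.map φ) (q.map φ) := by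
  obtain ⟨v, rfl, rfl⟩ := h
  exact ⟨v.map φ, by rw [map_mul_map, map_conjTranspose_map],
    by rw [map_mul_map, map_conjTranspose_map]⟩

/-- The homomorphism `V(B) → V(C)` induced by a `*`-homomorphism `B → C`. -/
def V.map (φ : B →⋆ₙₐ[ℂ] C) : V B →+ V C where
  toFun := Quotient.map (MatProj.map φ) fun _ _ h => MvN.map φ h
  map_zero' := by
    refine V.mk_eq_mk.2 ?_
    refine ⟨0, ?_, ?_⟩ <;>
    · ext i
      exact i.elim0
  map_add' x y := by
    induction x using Quotient.inductionOn with | _ p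
    induction y using Quotient.inductionOn with | _ q
    refine V.mk_eq_mk.2 ?_
    have h : (Matrix.fromBlocks p.mat 0 0 q.mat).map φ =
        Matrix.fromBlocks (p.mat.map φ) 0 0 (q.mat.map φ) := by
      rw [Matrix.fromBlocks_map]
      simp
    have h' : ((p.sum q).map φ).mat = ((p.map φ).sum (q.map φ)).mat :=
      congrArg (fun M => M.submatrix finSumFinEquiv.symm finSumFinEquiv.symm) h
    rw [← h']
    exact (matProjSetoid C).refl ((p.sum q).map φ)

theorem V.map_mk (φ : B →⋆ₙₐ[ℂ] C) (p : MatProj B) : V.map φ (V.mk p) = V.mk (p.map φ) := rfl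

end Functoriality

/-! ### The ordered group `K₀(A)` -/

/-- `K₀₀(B)`, the Grothendieck group of `V(B)`. For unital `B` this is `K₀(B)`. -/
abbrev K00 (B : Type u) [NonUnitalRing B] [StarRing B] : Type u :=
  Algebra.GrothendieckAddGroup (V B)

/-- The homomorphism `K₀₀(B) → K₀₀(C)` induced by a `*`-homomorphism `B → C`. -/
def K00.map {B C : Type*} [NonUnitalRing B] [StarRing B] [Module ℂ B]
    [NonUnitalRing C] [StarRing C] [Module ℂ C] (φ : B →⋆ₙₐ[ℂ] C) : K00 B →+ K00 C :=
  Algebra.GrothendieckAddGroup.lift (Algebra.GrothendieckAddGroup.of.comp (V.map φ))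

theorem K00.map_of {B C : Type*} [NonUnitalRing B] [StarRing B] [Module ℂ B]
    [NonUnitalRing C] [StarRing C] [Module ℂ C] (φ : B →⋆ₙₐ[ℂ] C) (x : V B) :
    K00.map φ (Algebra.GrothendieckAddGroup.of x) =
      Algebra.GrothendieckAddGroup.of (V.map φ x) :=
  DFunLike.congr_fun (Algebra.GrothendieckAddGroup.lift.symm_apply_apply
    (Algebra.GrothendieckAddGroup.of.comp (V.map φ))) x

section CStar

variable (A : Type u) [NonUnitalCStarAlgebra A]

/-- The canonical character `a + λ1 ↦ λ` of the unitization of `A`. -/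
def scalarHom : Unitization ℂ A →⋆ₙₐ[ℂ] ℂ where
  toFun x := x.fst
  map_smul' _ _ := rfl
  map_zero' := rfl
  map_add' _ _ := rfl
  map_mul' _ _ := rfl
  map_star' _ := rfl

/-- `K₀(A)`: the kernel of the map `K₀₀(A⁺) → K₀₀(ℂ)` induced by the canonical character of
`A⁺ = A + ℂ1`, where a new unit is adjoined whether or not `A` has one. (For unital `A` the
inclusion `A → A⁺ ≅ A × ℂ` identifies this group with `K₀₀(A)`.) -/
def K0 : Type u := (K00.map (scalarHom A)).ker

instance : AddCommGroup (K0 A) := inferInstanceAs (AddCommGroup (K00.map (scalarHom A)).ker)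

theorem V_map_scalarHom_inr (x : V A) :
    V.map (scalarHom A) (V.map (Unitization.inrNonUnitalStarAlgHom ℂ A) x) = 0 := by
  induction x using Quotient.inductionOn with | _ p
  refine V.mk_eq_mk.2 ⟨0, ?_, ?_⟩
  · rw [Matrix.mul_zero]
    ext i j
    exact (Unitization.fst_inr ℂ (p.mat i j)).symm
  · ext i
    exact i.elim0

/-- The additive map `V(A) → K₀(A)` induced by the inclusion of `A` in its unitization. -/
def V.toK0 : V A →+ K0 A :=
  (Algebra.GrothendieckAddGroup.of.comp
    (V.map (Unitization.inrNonUnitalStarAlgHom ℂ A))).codRestrict (K00.map (scalarHom A)).ker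
    fun x => by
      rw [AddMonoidHom.mem_ker]
      change K00.map (scalarHom A) (Algebra.GrothendieckAddGroup.of _) = 0
      rw [K00.map_of, V_map_scalarHom_inr, map_zero]

variable {A} in
/-- The class `[p]₀ ∈ K₀(A)` of a projection `p ∈ P_∞(A)`. -/
def cls (p : MatProj A) : K0 A := V.toK0 A (V.mk p)

/-- The positive cone `K₀(A)⁺ = {[p]₀ | p ∈ P_∞(A)}`. -/
def K0Pos : AddSubmonoid (K0 A) where
  carrier := {x | ∃ p : MatProj A, x = cls p}
  zero_mem' := ⟨MatProj.empty, (map_zero (V.toK0 A)).symm⟩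
  add_mem' := by
    rintro _ _ ⟨p, rfl⟩ ⟨q, rfl⟩
    exact ⟨p.sum q, (map_add (V.toK0 A) (V.mk p) (V.mk q)).symm⟩

/-- The (pre)order of `K₀(A)`: `x ≤ y` means `y - x ∈ K₀(A)⁺`. -/
instance : LE (K0 A) := ⟨fun x y => y - x ∈ K0Pos A⟩

/-- The dimension range `D₀(A) = {[p]₀ | p ∈ P(A)}`. -/
def dimRange : Set (K0 A) :=
  {x | ∃ (p : A) (hp : IsStarProjection p), x = cls (MatProj.single p hp)}

/-- `A` has cancellation: `[p]₀ = [q]₀ ↔ p ∼ q` for all `p, q ∈ P_∞(A)`. -/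
def HasCancellation : Prop :=
  ∀ p q : MatProj A, cls p = cls q ↔ MvN p.mat q.mat

/-- `A` has real rank zero: the invertible self-adjoint elements are dense in the self-adjoint
elements of the unitization of `A`. (A new unit is adjoined whether or not `A` has one; for unital
`A` the unitization is `A × ℂ`, so this says the same as density in `A` itself.) -/
def HasRealRankZero : Prop :=
  ∀ x : Unitization ℂ A, IsSelfAdjoint x →
    x ∈ closure {y : Unitization ℂ A | IsSelfAdjoint y ∧ IsUnit y}

variable {A}

/-- The singular value function of `a`:
`s_g(a) = inf {‖a - a p‖ | p ∈ P(A), [p]₀ ≤ g}` for `g ∈ K₀(A)⁺`. -/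
def singularValue (g : K0Pos A) (a : A) : ℝ :=
  sInf {r : ℝ | ∃ (p : A) (hp : IsStarProjection p),
    cls (MatProj.single p hp) ≤ (g : K0 A) ∧ r = ‖a - a * p‖}

end CStar

end CStarK

end

/-!
Let `p` and `q` be nearly optimal for `s_g(a)` and `s_h(b)`. A projection `f` under which both
`pb` and `q` are supported satisfies `ab(1 - f) = a(1 - p) b(1 - q)(1 - f)`, so that
`‖ab(1 - f)‖ ≤ ‖a(1 - p)‖ ‖b(1 - q)‖`; it remains to find such an `f`, up to an error in norm, with
`[f]₀ ≤ [p]₀ + [q]₀`.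

Put `x = (pb)* (pb) + q` in the unitization of `A`. In a von Neumann algebra one would take for `f`
the spectral projection of `x` for `(2δ, ∞)`. By real rank zero, `x - 2δ` is within `δ` of an
invertible self-adjoint `z`, and the indicator function of `(0, ∞)` is continuous on the spectrum
of `z`; the projection `f` it defines satisfies `f x f ≥ δ f` and `(1 - f) x (1 - f) ≤ 3δ`
(`exists_approx_spectral_projection`). The second inequality makes `pb(1 - f)` and `q(1 - f)` small.
By the first, `f x f + δ(1 - f)` has an inverse square root `d`, commuting with `f`, and the column
with entries `v = pb f d` and `w = q f d` satisfies `v* v + w* w = f`. It thus implements an equivalence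
of `f` with a subprojection of `p ⊕ q`, which is the estimate of the class of `f`
(`cls_single_le_add`); it also shows that `f` lies in `A`, an ideal of the unitization. Both
conclusions are combined in `exists_approx_support`.
-/

noncomputable section

namespace CStarK

/-! ### Spectral projections -/

section Spectral

variable {B : Type*} [CStarAlgebra B] [PartialOrder B] [StarOrderedRing B]

/-- An invertible self-adjoint element has a positive spectral projection: `0` is not in the
spectrum, so that the indicator function of `(0, ∞)` is continuous there. -/
theorem exists_isStarProjection_conjugate_nonneg {z : B} (hz : IsSelfAdjoint z) (hu : IsUnit z) :
    ∃ f : B, IsStarProjection f ∧ 0 ≤ f * z * f ∧ (1 - f) * z * (1 - f) ≤ 0 := by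
  set χ : ℝ → ℝ := fun s => if 0 < s then 1 else 0 with hχ
  have h0 : (0 : ℝ) ∉ spectrum ℝ z := (spectrum.zero_notMem_iff ℝ).2 hu
  have hc : ContinuousOn χ (spectrum ℝ z) := by
    intro s hs
    refine ContinuousAt.continuousWithinAt ?_
    rcases lt_trichotomy s 0 with h | h | h
    · refine (continuousAt_const (y := (0 : ℝ))).congr ?_
      filter_upwards [Iio_mem_nhds h] with t ht
      exact (if_neg (not_lt.2 (le_of_lt ht))).symm
    · exact absurd (h ▸ hs) h0
    · refine (continuousAt_const (y := (1 : ℝ))).congr ?_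
      filter_upwards [Ioi_mem_nhds h] with t ht
      exact (if_pos ht).symm
  have hc' : ContinuousOn (fun s => 1 - χ s) (spectrum ℝ z) := continuousOn_const.sub hc
  have hid : ContinuousOn (fun s : ℝ => s) (spectrum ℝ z) := continuousOn_id
  have h1 : 1 - cfc χ z = cfc (fun s => 1 - χ s) z := by
    rw [cfc_sub _ _ z continuousOn_const hc, cfc_const_one ℝ z]
  refine ⟨cfc χ z, ⟨?_, cfc_predicate χ z⟩, ?_, ?_⟩
  · change cfc χ z * cfc χ z = cfc χ z
    rw [← cfc_mul χ χ z hc hc]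
    refine cfc_congr fun s _ => ?_
    by_cases h : 0 < s <;> simp [hχ, h]
  · have : cfc χ z * z * cfc χ z = cfc (fun s => χ s * s * χ s) z := by
      rw [cfc_mul (fun s => χ s * s) χ z (hc.mul hid) hc, cfc_mul χ (fun s => s) z hc hid,
        cfc_id' ℝ z]
    rw [this]
    refine cfc_nonneg fun s _ => ?_
    by_cases h : 0 < s <;> simp [hχ, h, le_of_lt]
  · have : (1 - cfc χ z) * z * (1 - cfc χ z) = cfc (fun s => (1 - χ s) * s * (1 - χ s)) z := by
      rw [h1, cfc_mul (fun s => (1 - χ s) * s) (fun s => 1 - χ s) z (hc'.mul hid) hc',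
        cfc_mul (fun s => 1 - χ s) (fun s => s) z hc' hid, cfc_id' ℝ z]
    rw [this]
    refine cfc_nonpos _ _ fun s _ => ?_
    by_cases h : 0 < s
    · simp [hχ, h]
    · simpa [hχ, h] using not_lt.1 h

/-- If an invertible self-adjoint element lies within `δ` of `x - 2δ`, then its positive spectral
projection `f` is an approximate spectral projection of `x`: the corner `f x f` is at least `δ`,
so that it can be normalised to `f` by an element commuting with `f`, and the corner of `x` under
`1 - f` is at most `3δ`. -/
theorem exists_approx_spectral_projection {x z : B} (hx : IsSelfAdjoint x) (hz : IsSelfAdjoint z)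
    (hu : IsUnit z) {δ : ℝ} (hδ : 0 < δ) (hxz : ‖x - algebraMap ℝ B (2 * δ) - z‖ ≤ δ) :
    ∃ f d : B, IsStarProjection f ∧ IsSelfAdjoint d ∧ Commute f d ∧
      d * (f * x * f) * d = f ∧ (1 - f) * x * (1 - f) ≤ algebraMap ℝ B (3 * δ) := by
  obtain ⟨f, hf, h1, h2⟩ := exists_isStarProjection_conjugate_nonneg hz hu
  have hff : f * f = f := hf.isIdempotentElem
  have hfs : IsSelfAdjoint f := hf.isSelfAdjoint
  have hgs : IsSelfAdjoint (1 - f) := hf.one_sub.isSelfAdjoint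
  have hgg : (1 - f) * (1 - f) = 1 - f := hf.one_sub.isIdempotentElem
  set y := x - algebraMap ℝ B (2 * δ) - z with hy
  have hys : IsSelfAdjoint y := (hx.sub (.algebraMap B (.all _))).sub hz
  have hyu : y ≤ algebraMap ℝ B δ :=
    hys.le_algebraMap_norm_self.trans (algebraMap_mono B hxz)
  have hyl : -algebraMap ℝ B δ ≤ y :=
    (neg_le_neg (algebraMap_mono B hxz)).trans hys.neg_algebraMap_norm_le_self
  have hxe : x = z + y + algebraMap ℝ B (2 * δ) := by rw [hy]; abel
  simp only [Algebra.algebraMap_eq_smul_one] at *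
  have h3 : δ • f ≤ f * x * f := by
    have h4 := hfs.conjugate_le_conjugate hyl
    have h5 : f * x * f = f * z * f + f * y * f + (2 * δ) • f := by
      rw [hxe]
      simp only [mul_add, add_mul, mul_smul_comm, smul_mul_assoc, mul_one, hff]
    have h6 : f * -(δ • (1 : B)) * f = -(δ • f) := by
      simp only [mul_neg, neg_mul, mul_smul_comm, smul_mul_assoc, mul_one, hff]
    rw [h6] at h4
    calc δ • f = 0 + -(δ • f) + (2 * δ) • f := by module
      _ ≤ _ := by rw [h5]; gcongr
  have h7 : (1 - f) * x * (1 - f) ≤ (3 * δ) • (1 : B) := by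
    have h4 := hgs.conjugate_le_conjugate hyu
    have h5 : (1 - f) * x * (1 - f) =
        (1 - f) * z * (1 - f) + (1 - f) * y * (1 - f) + (2 * δ) • (1 - f) := by
      conv_lhs => rw [hxe]
      simp only [mul_add, add_mul, mul_smul_comm, smul_mul_assoc, mul_one, hgg]
    have h6 : (1 - f) * (δ • (1 : B)) * (1 - f) = δ • (1 - f) := by
      simp only [mul_smul_comm, smul_mul_assoc, mul_one, hgg]
    rw [h6] at h4
    calc _ ≤ 0 + δ • (1 - f) + (2 * δ) • (1 - f) := by rw [h5]; gcongr
      _ = (3 * δ) • (1 - f) := by module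
      _ ≤ (3 * δ) • (1 : B) := by
        refine smul_le_smul_of_nonneg_left ?_ (by positivity)
        exact sub_le_self _ hf.nonneg
  -- `c` is `f x f`, made invertible on the complementary corner; `d` is its inverse square root.
  set c := f * x * f + δ • (1 - f) with hcd
  have hcl : δ • (1 : B) ≤ c := by
    calc δ • (1 : B) = δ • f + δ • (1 - f) := by module
      _ ≤ c := by rw [hcd]; gcongr
  have hcp : IsStrictlyPositive c :=
    IsStrictlyPositive.of_le (IsStrictlyPositive.smul hδ isStrictlyPositive_one) hcl
  have hfc : f * c = f * x * f := by
    simp only [hcd, mul_add, mul_smul_comm, mul_sub, mul_one, hff, sub_self, smul_zero, add_zero,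
      ← mul_assoc]
  have hcf : c * f = f * x * f := by
    simp only [hcd, add_mul, smul_mul_assoc, sub_mul, one_mul, hff, sub_self, smul_zero, add_zero,
      mul_assoc]
  have hcomm : Commute c f := hcf.trans hfc.symm
  have hd : Commute (c ^ (-(1 / 2) : ℝ)) f := hcomm.cfc_nnreal _
  refine ⟨f, c ^ (-(1 / 2) : ℝ), hf, .of_nonneg CFC.rpow_nonneg, hd.symm, ?_, h7⟩
  calc c ^ (-(1 / 2) : ℝ) * (f * x * f) * c ^ (-(1 / 2) : ℝ)
      = f * (c ^ (-(1 / 2) : ℝ) * c * c ^ (-(1 / 2) : ℝ)) := by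
        rw [← hfc, ← mul_assoc, hd.eq]; simp only [mul_assoc]
    _ = f := by rw [CFC.conjugate_rpow_neg_one_half c hcp, mul_one]

end Spectral

/-! ### Block columns over a ring without unit -/

section Columns

variable {B : Type*} [NonUnitalRing B] {k l m n : Type*}

theorem conjTranspose_fromRows_mul_fromRows [StarRing B] [Fintype k] [Fintype l]
    (v : Matrix k n B) (w : Matrix l n B) :
    (Matrix.fromRows v w)ᴴ * Matrix.fromRows v w = vᴴ * v + wᴴ * w := by
  ext i j
  simp [Matrix.mul_apply]

theorem fromRows_mul_conjTranspose_fromRows [StarRing B] [Fintype n]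
    (v : Matrix k n B) (w : Matrix l n B) :
    Matrix.fromRows v w * (Matrix.fromRows v w)ᴴ =
      Matrix.fromBlocks (v * vᴴ) (v * wᴴ) (w * vᴴ) (w * wᴴ) := by
  ext (i | i) (j | j) <;> simp [Matrix.mul_apply]

theorem fromRows_mul_right [Fintype n] (v : Matrix k n B) (w : Matrix l n B)
    (p : Matrix n m B) :
    Matrix.fromRows v w * p = Matrix.fromRows (v * p) (w * p) := by
  ext (i | i) j <;> simp [Matrix.mul_apply]

theorem fromBlocks_diag_mul_fromRows [Fintype k] [Fintype l]
    (q : Matrix k k B) (r : Matrix l l B) (v : Matrix k n B)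
    (w : Matrix l n B) :
    Matrix.fromBlocks q 0 0 r * Matrix.fromRows v w = Matrix.fromRows (q * v) (r * w) := by
  ext (i | i) j <;> simp [Matrix.mul_apply]

end Columns

/-! ### Comparison of projections in `K₀` -/

section Comparison

/-- The sum of two orthogonal projections is equivalent to their block diagonal sum. -/
theorem MvN.add_fromBlocks {B : Type*} [NonUnitalRing B] [StarRing B] {n : Type*} [Fintype n]
    {e f : Matrix n n B} (he : IsStarProjection e) (hf : IsStarProjection f) (hef : e * f = 0) :
    MvN (e + f) (Matrix.fromBlocks e 0 0 f) := by
  have h1 : e * e = e := he.isIdempotentElem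
  have h2 : eᴴ = e := he.isSelfAdjoint
  have h3 : f * f = f := hf.isIdempotentElem
  have h4 : fᴴ = f := hf.isSelfAdjoint
  have h5 : f * e = 0 := by
    rw [← h2, ← h4, ← Matrix.conjTranspose_mul, hef, Matrix.conjTranspose_zero]
  refine ⟨Matrix.fromRows e f, ?_, ?_⟩
  · rw [conjTranspose_fromRows_mul_fromRows, h2, h4, h1, h3]
  · rw [fromRows_mul_conjTranspose_fromRows, h2, h4, h1, h3, hef, h5]

variable {A : Type*} [NonUnitalCStarAlgebra A]

theorem cls_eq_of_mvN {p q : MatProj A} (h : MvN p.mat q.mat) : cls p = cls q :=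
  congrArg (V.toK0 A) (V.mk_eq_mk.2 h)

theorem cls_sum (p q : MatProj A) : cls (p.sum q) = cls p + cls q :=
  map_add (V.toK0 A) (V.mk p) (V.mk q)

theorem K0.le_trans {x y z : K0 A} (h : x ≤ y) (h' : y ≤ z) : x ≤ z := by
  change z - x ∈ K0Pos A
  rw [← sub_add_sub_cancel z y x]
  exact add_mem h' h

theorem K0.add_le_add {x y x' y' : K0 A} (h : x ≤ y) (h' : x' ≤ y') : x + x' ≤ y + y' := by
  change y + y' - (x + x') ∈ K0Pos A
  rw [add_sub_add_comm]
  exact add_mem h h'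

/-- If `p = w* w` and the range of `w` lies under `q`, then `w w*` is a subprojection of `q`
equivalent to `p`, whence `[p]₀ ≤ [q]₀`. -/
theorem cls_le_cls {p q : MatProj A} {w : Matrix (Fin q.size) (Fin p.size) A}
    (h : wᴴ * w = p.mat) (hp : w * p.mat = w) (hq : q.mat * w = w) : cls p ≤ cls q := by
  have hq2 : q.matᴴ = q.mat := q.isProj.isSelfAdjoint
  have hqe : q.mat * (w * wᴴ) = w * wᴴ := by rw [← Matrix.mul_assoc, hq]
  have heq : (w * wᴴ) * q.mat = w * wᴴ := by
    simpa [Matrix.conjTranspose_mul, hq2] using congrArg Matrix.conjTranspose hqe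
  have he : IsStarProjection (w * wᴴ) := by
    refine ⟨?_, ?_⟩
    · change w * wᴴ * (w * wᴴ) = w * wᴴ
      rw [Matrix.mul_assoc, ← Matrix.mul_assoc wᴴ, h, ← Matrix.mul_assoc, hp]
    · change (w * wᴴ)ᴴ = w * wᴴ
      rw [Matrix.conjTranspose_mul, Matrix.conjTranspose_conjTranspose]
  have hee : (w * wᴴ) * (w * wᴴ) = w * wᴴ := he.isIdempotentElem
  have hs : IsStarProjection (q.mat - w * wᴴ) := he.sub_of_mul_eq_left q.isProj heq
  let e : MatProj A := ⟨q.size, w * wᴴ, he⟩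
  let s : MatProj A := ⟨q.size, q.mat - w * wᴴ, hs⟩
  have h1 : cls p = cls e := cls_eq_of_mvN ⟨w, h, rfl⟩
  have h2 : cls q = cls (e.sum s) := by
    refine cls_eq_of_mvN (MvN.trans q.isProj (e.sum s).isProj ?_ (e.mvn_sum s).symm)
    have h3 := MvN.add_fromBlocks he hs (by rw [Matrix.mul_sub, heq, hee, sub_self])
    rwa [add_sub_cancel] at h3
  change cls q - cls p ∈ K0Pos A
  rw [h1, h2, cls_sum, add_sub_cancel_left]
  exact ⟨s, rfl⟩

/-- A projection `p = v* v + w* w` with `v` and `w` having range under `q` and `r` is equivalent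
to a subprojection of `q ⊕ r`, through the column with entries `v` and `w`. -/
theorem cls_le_cls_add_cls {p q r : MatProj A} {v : Matrix (Fin q.size) (Fin p.size) A}
    {w : Matrix (Fin r.size) (Fin p.size) A} (h : vᴴ * v + wᴴ * w = p.mat)
    (hvp : v * p.mat = v) (hwp : w * p.mat = w) (hqv : q.mat * v = v) (hrw : r.mat * w = w) :
    cls p ≤ cls q + cls r := by
  rw [← cls_sum]
  let e := (finSumFinEquiv (m := q.size) (n := r.size)).symm
  let u : Matrix (Fin (q.sum r).size) (Fin p.size) A := (Matrix.fromRows v w).submatrix e id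
  refine cls_le_cls (p := p) (q := q.sum r) (w := u) ?_ ?_ ?_
  · change ((Matrix.fromRows v w).submatrix e id)ᴴ * (Matrix.fromRows v w).submatrix e id = _
    rw [Matrix.conjTranspose_submatrix, Matrix.submatrix_mul_equiv,
      conjTranspose_fromRows_mul_fromRows, h]
    rfl
  · change (Matrix.fromRows v w).submatrix e (Equiv.refl _) * p.mat.submatrix (Equiv.refl _) id =
      (Matrix.fromRows v w).submatrix e id
    rw [Matrix.submatrix_mul_equiv, fromRows_mul_right, hvp, hwp]
  · change (Matrix.fromBlocks q.mat 0 0 r.mat).submatrix e e *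
      (Matrix.fromRows v w).submatrix e id = (Matrix.fromRows v w).submatrix e id
    rw [Matrix.submatrix_mul_equiv, fromBlocks_diag_mul_fromRows, hqv, hrw]

/-- The comparison of `p = v* v + w* w` with `q ⊕ r` for projections of `A` itself. -/
theorem cls_single_le_add {p q r : A} (hp : IsStarProjection p) (hq : IsStarProjection q)
    (hr : IsStarProjection r) {v w : A} (h : star v * v + star w * w = p)
    (hvp : v * p = v) (hwp : w * p = w) (hqv : q * v = v) (hrw : r * w = w) :
    cls (MatProj.single p hp) ≤ cls (MatProj.single q hq) + cls (MatProj.single r hr) := by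
  refine cls_le_cls_add_cls (p := MatProj.single p hp) (q := MatProj.single q hq)
    (r := MatProj.single r hr) (v := Matrix.of fun _ _ : Fin 1 => v)
    (w := Matrix.of fun _ _ : Fin 1 => w) ?_ ?_ ?_ ?_ ?_
  · change (Matrix.of fun _ _ : Fin 1 => v)ᴴ * (Matrix.of fun _ _ : Fin 1 => v) +
      (Matrix.of fun _ _ : Fin 1 => w)ᴴ * (Matrix.of fun _ _ : Fin 1 => w) =
      Matrix.of fun _ _ : Fin 1 => p
    ext i j
    simp [Matrix.mul_apply, h]
  · change (Matrix.of fun _ _ : Fin 1 => v) * (Matrix.of fun _ _ : Fin 1 => p) =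
      Matrix.of fun _ _ : Fin 1 => v
    ext i j
    simp [Matrix.mul_apply, hvp]
  · change (Matrix.of fun _ _ : Fin 1 => w) * (Matrix.of fun _ _ : Fin 1 => p) =
      Matrix.of fun _ _ : Fin 1 => w
    ext i j
    simp [Matrix.mul_apply, hwp]
  · change (Matrix.of fun _ _ : Fin 1 => q) * (Matrix.of fun _ _ : Fin 1 => v) =
      Matrix.of fun _ _ : Fin 1 => v
    ext i j
    simp [Matrix.mul_apply, hqv]
  · change (Matrix.of fun _ _ : Fin 1 => r) * (Matrix.of fun _ _ : Fin 1 => w) =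
      Matrix.of fun _ _ : Fin 1 => w
    ext i j
    simp [Matrix.mul_apply, hrw]

theorem cls_single_zero : cls (MatProj.single (0 : A) (.zero A)) = 0 := by
  rw [← map_zero (V.toK0 A)]
  refine cls_eq_of_mvN (q := MatProj.empty) ⟨0, ?_, ?_⟩
  · rw [Matrix.mul_zero]
    rfl
  · ext i
    exact i.elim0

end Comparison

/-! ### Approximate right support projections in real rank zero -/

section RealRankZero

theorem inr_snd_of_fst_eq_zero {A : Type*} [Zero A] {x : Unitization ℂ A} (h : x.fst = 0) :
    ((x.snd : A) : Unitization ℂ A) = x :=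
  Unitization.ext h.symm rfl

variable {A : Type*} [NonUnitalCStarAlgebra A]

/-- Elements `y₁` and `y₂` with ranges under `p₁` and `p₂` almost vanish off a common projection
`f` whose class is at most `[p₁]₀ + [p₂]₀`: an approximate spectral projection of
`y₁* y₁ + y₂* y₂`. It lies in `A`, not only in the unitization, because it is a combination of
multiples of `y₁` and `y₂`. -/
theorem exists_approx_support (hrr : HasRealRankZero A) {p₁ p₂ y₁ y₂ : A}
    (hp₁ : IsStarProjection p₁) (hp₂ : IsStarProjection p₂) (hy₁ : p₁ * y₁ = y₁)
    (hy₂ : p₂ * y₂ = y₂) {ε : ℝ} (hε : 0 < ε) :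
    ∃ (f : A) (hf : IsStarProjection f),
      cls (MatProj.single f hf) ≤ cls (MatProj.single p₁ hp₁) + cls (MatProj.single p₂ hp₂) ∧
      ‖y₁ - y₁ * f‖ ≤ ε ∧ ‖y₂ - y₂ * f‖ ≤ ε := by
  let _ := CStarAlgebra.spectralOrder (Unitization ℂ A)
  have := CStarAlgebra.spectralOrderedRing (Unitization ℂ A)
  set Y₁ : Unitization ℂ A := (y₁ : Unitization ℂ A) with hY₁
  set Y₂ : Unitization ℂ A := (y₂ : Unitization ℂ A) with hY₂
  set x := star Y₁ * Y₁ + star Y₂ * Y₂ with hx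
  have hxs : IsSelfAdjoint x := (IsSelfAdjoint.star_mul_self _).add (IsSelfAdjoint.star_mul_self _)
  -- With this `δ`, the bound `3δ` on the complementary corner of `x` is `ε²`.
  set δ := ε ^ 2 / 3 with hδe
  have hδ : 0 < δ := by positivity
  obtain ⟨z, ⟨hz, hu⟩, hxz⟩ := Metric.mem_closure_iff.1
    (hrr (x - algebraMap ℝ _ (2 * δ)) (hxs.sub (.algebraMap _ (.all _)))) δ hδ
  rw [dist_eq_norm] at hxz
  obtain ⟨F, d, hF, hd, hFd, hdF, hle⟩ := exists_approx_spectral_projection hxs hz hu hδ hxz.le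
  have hFF : F * F = F := hF.isIdempotentElem
  have hFs : star F = F := hF.isSelfAdjoint
  have hds : star d = d := hd
  have hv : (((Y₁ * F * d).snd : A) : Unitization ℂ A) = Y₁ * F * d :=
    inr_snd_of_fst_eq_zero (by simp [hY₁])
  have hw : (((Y₂ * F * d).snd : A) : Unitization ℂ A) = Y₂ * F * d :=
    inr_snd_of_fst_eq_zero (by simp [hY₂])
  set v : A := (Y₁ * F * d).snd
  set w : A := (Y₂ * F * d).snd
  set f : A := star v * v + star w * w with hf
  have hfF : (f : Unitization ℂ A) = F := by
    rw [hf, Unitization.inr_add, Unitization.inr_mul, Unitization.inr_mul, Unitization.inr_star,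
      Unitization.inr_star, hv, hw]
    conv_rhs => rw [← hdF, hx]
    simp only [star_mul, hFs, hds, mul_add, add_mul, mul_assoc]
  have hinj := Unitization.inr_injective (R := ℂ) (A := A)
  have hfp : IsStarProjection f := by
    refine ⟨hinj ?_, hinj ?_⟩
    · rw [Unitization.inr_mul, hfF, hFF]
    · rw [Unitization.inr_star, hfF, hFs]
  have hright : ∀ Y : Unitization ℂ A, Y * F * d * F = Y * F * d := fun Y => by
    rw [mul_assoc, ← hFd.eq, mul_assoc, ← mul_assoc F F, hFF, ← mul_assoc]
  have hcorner : ∀ Y : Unitization ℂ A, star Y * Y ≤ x → ‖Y - Y * F‖ ≤ ε := fun Y hY => by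
    have h1 : star (Y - Y * F) * (Y - Y * F) = (1 - F) * (star Y * Y) * (1 - F) := by
      rw [← mul_one_sub, star_mul, hF.one_sub.isSelfAdjoint.star_eq]
      simp only [mul_assoc]
    have h2 : star (Y - Y * F) * (Y - Y * F) ≤ algebraMap ℝ _ (3 * δ) := by
      rw [h1]
      exact (hF.one_sub.isSelfAdjoint.conjugate_le_conjugate hY).trans hle
    have h3 := (CStarAlgebra.norm_le_iff_le_algebraMap _ (by positivity)
      (star_mul_self_nonneg _)).2 h2
    rw [CStarRing.norm_star_mul_self] at h3
    nlinarith [norm_nonneg (Y - Y * F)]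
  refine ⟨f, hfp, ?_, ?_, ?_⟩
  · refine cls_single_le_add hfp hp₁ hp₂ hf.symm (hinj ?_) (hinj ?_) (hinj ?_) (hinj ?_)
    · rw [Unitization.inr_mul, hv, hfF, hright]
    · rw [Unitization.inr_mul, hw, hfF, hright]
    · rw [Unitization.inr_mul, hv, ← mul_assoc, ← mul_assoc, hY₁, ← Unitization.inr_mul, hy₁]
    · rw [Unitization.inr_mul, hw, ← mul_assoc, ← mul_assoc, hY₂, ← Unitization.inr_mul, hy₂]
  · rw [← Unitization.norm_inr (𝕜 := ℂ), Unitization.inr_sub, Unitization.inr_mul, hfF]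
    exact hcorner _ (le_add_of_nonneg_right (star_mul_self_nonneg _))
  · rw [← Unitization.norm_inr (𝕜 := ℂ), Unitization.inr_sub, Unitization.inr_mul, hfF]
    exact hcorner _ (le_add_of_nonneg_left (star_mul_self_nonneg _))

end RealRankZero

/-! ### Singular values -/

section SingularValue

variable {A : Type*} [NonUnitalCStarAlgebra A]

theorem norm_sub_mul_le {p : A} (hp : IsStarProjection p) (a : A) : ‖a - a * p‖ ≤ ‖a‖ := by
  rw [← Unitization.norm_inr (𝕜 := ℂ), Unitization.inr_sub, Unitization.inr_mul, ← mul_one_sub]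
  have hP : IsStarProjection (p : Unitization ℂ A) :=
    hp.map (Unitization.inrNonUnitalStarAlgHom ℂ A)
  calc _ ≤ ‖(a : Unitization ℂ A)‖ * ‖1 - (p : Unitization ℂ A)‖ := norm_mul_le _ _
    _ ≤ ‖(a : Unitization ℂ A)‖ * 1 := by gcongr; exact hP.one_sub.norm_le
    _ = ‖a‖ := by rw [mul_one, Unitization.norm_inr]

theorem singularValue_le (g : K0Pos A) (a : A) {p : A} (hp : IsStarProjection p)
    (h : cls (MatProj.single p hp) ≤ (g : K0 A)) : singularValue g a ≤ ‖a - a * p‖ := by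
  refine csInf_le ⟨0, ?_⟩ ⟨p, hp, h, rfl⟩
  rintro _ ⟨_, _, _, rfl⟩
  exact norm_nonneg _

/-- The infimum defining `s_g(a)` is over a nonempty set, since the projection `0` is
admissible; it is therefore approached by admissible projections. -/
theorem exists_norm_lt_of_singularValue_lt {g : K0Pos A} {a : A} {t : ℝ}
    (h : singularValue g a < t) : ∃ (p : A) (hp : IsStarProjection p),
      cls (MatProj.single p hp) ≤ (g : K0 A) ∧ ‖a - a * p‖ < t := by
  obtain ⟨_, ⟨p, hp, hpg, rfl⟩, hlt⟩ := exists_lt_of_csInf_lt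
    (s := {r : ℝ | ∃ (p : A) (hp : IsStarProjection p),
      cls (MatProj.single p hp) ≤ (g : K0 A) ∧ r = ‖a - a * p‖})
    ⟨_, 0, .zero A, by
      change (g : K0 A) - _ ∈ K0Pos A
      rw [cls_single_zero, sub_zero]
      exact g.2, rfl⟩ h
  exact ⟨p, hp, hpg, hlt⟩

/-- The estimate follows from the decomposition
`ab(1 - f) = a(1 - p) b(1 - q)(1 - f) + a(1 - p) b q(1 - f) + a p b(1 - f)`, with `f` an
approximate common right support of `pb` and `q`. -/
theorem singularValue_mul_le_norm_mul_norm (hrr : HasRealRankZero A) (a b : A) (g h : K0Pos A)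
    {p q : A} (hp : IsStarProjection p) (hq : IsStarProjection q)
    (hpg : cls (MatProj.single p hp) ≤ (g : K0 A))
    (hqh : cls (MatProj.single q hq) ≤ (h : K0 A)) :
    singularValue (g + h) (a * b) ≤ ‖a - a * p‖ * ‖b - b * q‖ := by
  have key : ∀ ε : ℝ, 0 < ε → singularValue (g + h) (a * b) ≤
      ‖a - a * p‖ * ‖b - b * q‖ + (‖a‖ * ‖b‖ + ‖a‖) * ε := by
    intro ε hε
    obtain ⟨f, hf, hfc, h1, h2⟩ := exists_approx_support hrr (y₁ := p * b) (y₂ := q) hp hq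
      (by rw [← mul_assoc, hp.isIdempotentElem]) hq.isIdempotentElem hε
    refine (singularValue_le (g + h) (a * b) hf
      (K0.le_trans hfc (K0.add_le_add hpg hqh))).trans ?_
    have hdec : a * b - a * b * f =
        (a - a * p) * ((b - b * q) - (b - b * q) * f) + (a - a * p) * (b * (q - q * f)) +
          a * (p * b - p * b * f) := by
      noncomm_ring
    have hap := norm_sub_mul_le hp a
    rw [hdec]
    refine (norm_add₃_le).trans ?_
    have e1 : ‖(a - a * p) * ((b - b * q) - (b - b * q) * f)‖ ≤ ‖a - a * p‖ * ‖b - b * q‖ :=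
      (norm_mul_le _ _).trans (by gcongr; exact norm_sub_mul_le hf _)
    have e2 : ‖(a - a * p) * (b * (q - q * f))‖ ≤ ‖a‖ * (‖b‖ * ε) :=
      (norm_mul_le _ _).trans (by
        gcongr
        exact (norm_mul_le _ _).trans (by gcongr))
    have e3 : ‖a * (p * b - p * b * f)‖ ≤ ‖a‖ * ε := (norm_mul_le _ _).trans (by gcongr)
    linarith
  refine le_of_forall_pos_le_add fun η hη => ?_
  have hC : 0 < ‖a‖ * ‖b‖ + ‖a‖ + 1 := by positivity
  refine (key (η / (‖a‖ * ‖b‖ + ‖a‖ + 1)) (by positivity)).trans ?_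
  gcongr
  rw [mul_div_assoc', div_le_iff₀ hC]
  nlinarith

end SingularValue

end CStarK

end

theorem mainTheorem2 {A : Type*} [NonUnitalCStarAlgebra A]
    (hcancel : CStarK.HasCancellation A)
    (hrr : CStarK.HasRealRankZero A)
    (hdim : (CStarK.K0Pos A : Set (CStarK.K0 A)) = CStarK.dimRange A)
    (a b : A) (g h : CStarK.K0Pos A) :
    CStarK.singularValue (g + h) (a * b) ≤
      CStarK.singularValue g a * CStarK.singularValue h b := by
  have key : ∀ η : ℝ, 0 < η → CStarK.singularValue (g + h) (a * b) ≤
      (CStarK.singularValue g a + η) * (CStarK.singularValue h b + η) := by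
    intro η hη
    obtain ⟨p, hp, hpg, hpa⟩ := CStarK.exists_norm_lt_of_singularValue_lt
      (lt_add_of_pos_right (CStarK.singularValue g a) hη)
    obtain ⟨q, hq, hqh, hqb⟩ := CStarK.exists_norm_lt_of_singularValue_lt
      (lt_add_of_pos_right (CStarK.singularValue h b) hη)
    exact (CStarK.singularValue_mul_le_norm_mul_norm hrr a b g h hp hq hpg hqh).trans
      (mul_le_mul hpa.le hqb.le (norm_nonneg _) ((norm_nonneg _).trans hpa.le))
  have hlim : Filter.Tendsto
      (fun η : ℝ => (CStarK.singularValue g a + η) * (CStarK.singularValue h b + η))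
      (nhdsWithin 0 (Set.Ioi 0))
      (nhds (CStarK.singularValue g a * CStarK.singularValue h b)) := by
    have hc : Continuous fun η : ℝ =>
        (CStarK.singularValue g a + η) * (CStarK.singularValue h b + η) := by fun_prop
    simpa using (hc.tendsto 0).mono_left nhdsWithin_le_nhds
  exact ge_of_tendsto hlim (Filter.eventually_of_mem self_mem_nhdsWithin key)
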